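/- Let $\Lambda,\Omega>0$ with $2\Omega\Lambda<1$ and let $s\ge 1$ be an integer. Let $S_{[0,\Lambda],s}$ be the set of complex measures $\mu=\sum_{j=1}^s c_j\delta_{t_j}$ on $\mathbb R$ with $c\in\mathbb C^s$ and $0\le t_1<\dots<t_s\le\Lambda$ (coefficients may vanish, so these are the measures with at most $s$ atoms, all in $[0,\Lambda]$), and put $\hat\mu(\omega)=\int e^{-2\pi i\omega t}\,d\mu(t)=\sum_j c_je^{-2\pi i\omega t_j}$. Let $d\ge 3$ and let $\Gamma=(V,E)$ be a Ramanujan graph of degree $d$, that is, a finite, simple, connected, $d$-regular graph such that the smallest nonzero eigenvalue $\lambda_1$ of its normalized Laplacian $(L_\Gamma\varphi)(v)=\varphi(v)-\frac1d\sum_{\{v,w\}\in E}\varphi(w)$ satisfies $\lambda_1\ge 1-\frac{2\sqrt{d-1}}{d}$. Suppose that its vertices $V=\{v_1,\dots,v_n\}$ are $n$ distinct points of $[-\Omega,\Omega]$, where $$n>\frac{6d\,\bigl(1+6/\ln(s/(\Lambda\Omega))\bigr)\,s}{d-2\sqrt{d-1}}.$$ Then the measurements $$|\hat\mu(v_j)|^2\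 (1\le j\le n),\qquad |\hat\mu(v_j)-\hat\mu(v_k)|^2,\quad |\hat\mu(v_j)-i\,\hat\mu(v_k)|^2\ \ (\{v_j,v_k\}\in E,\ j<k)$$ are $M=(d+1)n$ in number, and they determine every $\mu\in S_{[0,\Lambda],s}$ up to a unimodular constant: for $\mu,\nu\in S_{[0,\Lambda],s}$, all these quantities agree for $\mu$ and $\nu$ if and only if $\mu=u\nu$ for some $u\in\mathbb C$ with $|u|=1$. -/

import Mathlib

open MeasureTheory

/-- `S_{[0,Λ],s}`: the complex measures `∑ j, c j • δ_{t j}` on the real line with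
`0 ≤ t 0 < ⋯ < t (s - 1) ≤ Λ`. The coefficients may vanish, so these are the complex measures
with at most `s` atoms, all of them in `[0, Λ]`. -/
def diracCombinations (L : ℝ) (s : ℕ) : Set (ComplexMeasure ℝ) :=
  {μ | ∃ (c : Fin s → ℂ) (t : Fin s → ℝ), StrictMono t ∧ (∀ j, t j ∈ Set.Icc 0 L) ∧
    μ = ∑ j, c j • VectorMeasure.dirac (t j) (1 : ℂ)}

/-- The Fourier transform `ω ↦ ∫ exp (-2π i ω t) dμ(t)` of a complex measure on the real line. -/
noncomputable def measureFourier (μ : ComplexMeasure ℝ) (ω : ℝ) : ℂ :=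
  VectorMeasure.integral μ
    (fun t : ℝ => Complex.exp (-2 * Real.pi * Complex.I * ω * t)) (ContinuousLinearMap.mul ℝ ℂ)

theorem smul_dirac_one (c : ℂ) (t : ℝ) :
    c • (VectorMeasure.dirac t (1 : ℂ) : ComplexMeasure ℝ) = VectorMeasure.dirac t c := by
  ext A hA
  by_cases h : t ∈ A <;> simp [hA, h]

/-- On a finite combination of Dirac measures, the Fourier transform is the exponential sum. -/
theorem measureFourier_sum_dirac {s : ℕ} (c : Fin s → ℂ) (t : Fin s → ℝ) (ω : ℝ) :
    measureFourier (∑ j, c j • VectorMeasure.dirac (t j) (1 : ℂ)) ω =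
      ∑ j, c j * Complex.exp (-2 * Real.pi * Complex.I * ω * t j) := by
  unfold measureFourier
  simp only [smul_dirac_one]
  rw [VectorMeasure.integral_finsetSum_vectorMeasure]
  · refine Finset.sum_congr rfl fun j _ => ?_
    rw [VectorMeasure.integral_dirac]
    simp [mul_comm]
  · intro j _
    rw [VectorMeasure.Integrable, VectorMeasure.variation_dirac]
    exact (integrable_dirac (by simp)).smul_measure (by simp)

/-- Equality up to a unimodular constant. -/
def PhaseEquiv (μ ν : ComplexMeasure ℝ) : Prop :=
  ∃ u : ℂ, ‖u‖ = 1 ∧ μ = u • ν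

/-- The normalized Laplace operator
`(L φ)(v) = φ v - (1 / deg v) ∑_{w adjacent to v} φ w` of a finite graph. -/
noncomputable def normalizedLaplacian {V : Type*} [Fintype V] (G : SimpleGraph V)
    [DecidableRel G.Adj] : (V → ℂ) →ₗ[ℂ] (V → ℂ) where
  toFun φ v := φ v - (1 / (G.degree v : ℂ)) * ∑ w ∈ G.neighborFinset v, φ w
  map_add' φ ψ := by
    ext v
    simp only [Pi.add_apply, Finset.sum_add_distrib]
    ring
  map_smul' a φ := by
    ext v
    simp only [Pi.smul_apply, smul_eq_mul, RingHom.id_apply, ← Finset.mul_sum]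
    ring

/-- The normalized spectral gap: the smallest nonzero eigenvalue of the normalized Laplace
operator (whose eigenvalues are real). -/
noncomputable def spectralGap {V : Type*} [Fintype V] (G : SimpleGraph V)
    [DecidableRel G.Adj] : ℝ :=
  sInf {l : ℝ | l ≠ 0 ∧ Module.End.HasEigenvalue (normalizedLaplacian G) (l : ℂ)}

/-- A `d`-regular connected finite graph, `d ≥ 3`, is Ramanujan if its normalized spectral gap
is at least `1 - 2 √(d - 1) / d`. -/
structure IsRamanujan {V : Type*} [Fintype V] (G : SimpleGraph V) [DecidableRel G.Adj]
    (d : ℕ) : Prop where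
  three_le : 3 ≤ d
  regular : G.IsRegularOfDegree d
  connected : G.Connected
  gap : 1 - 2 * Real.sqrt ((d : ℝ) - 1) / d ≤ spectralGap G

/-- The edges `{j, k}` of a graph on `{0, …, n - 1}`, written as pairs with `j < k`. -/
abbrev OrderedEdge {n : ℕ} (G : SimpleGraph (Fin n)) : Type :=
  {e : Fin n × Fin n // e.1 < e.2 ∧ G.Adj e.1 e.2}

/-- One measured quantity for each vertex and two for each edge. -/
abbrev MeasurementIndex {n : ℕ} (G : SimpleGraph (Fin n)) : Type :=
  Fin n ⊕ OrderedEdge G ⊕ OrderedEdge G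

/-- The magnitude measurements of a function `f` on the real line (to be applied to the Fourier
transform of a measure) associated with the graph whose vertices are the points `v j`:
`|f (v j)|²` for all vertices, and `|f (v j) - f (v k)|²`, `|f (v j) - i f (v k)|²` for all
edges with `j < k`. -/
noncomputable def magnitudes {n : ℕ} (G : SimpleGraph (Fin n)) (v : Fin n → ℝ) (f : ℝ → ℂ) :
    MeasurementIndex G → ℝ
  | Sum.inl j => ‖f (v j)‖ ^ 2
  | Sum.inr (Sum.inl e) => ‖f (v e.1.1) - f (v e.1.2)‖ ^ 2
  | Sum.inr (Sum.inr e) => ‖f (v e.1.1) - Complex.I * f (v e.1.2)‖ ^ 2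

/-! By polarization, the magnitudes determine the product of one transform value with the conjugate
of the other along every edge. If `μ` and `ν` share them, the ratio u of their transforms is
therefore constant along edges avoiding the set Z of vertices where the transform of `ν` vanishes.

Analytic input (`card_zeros_expSum_le`): a nonzero exponential sum with m frequencies in [0, L] has
at most m - 1 + Lℓ/π zeros on a real interval of length ℓ. Since 2ΩL < 1, the transform of a nonzero
measure carried by m points of [0, L] has at most m zeros in [-Ω, Ω] (`diracSum_eq_zero`). So |Z| ≤
s if ν ≠ 0, and if u takes a value a more than 2s times, then μ = aν. The zero bound rests on a
discrete Rolle inequality for turning around the origin (`turn.sum_le_pi_add_sum_sub`): each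
frequency after the first allows at most π more turning, while each real zero forces almost π of
turning on a line just above the real axis.

Graph input (`card_le_of_level_sets_le`): deleting few vertices from an expander cannot leave only
small pieces. If every level set of u had at most 2s elements, a lower bound γ ≤ 1 for the spectral
gap would give γ(n - |Z|)(1 - 2s/n) ≤ |Z| ≤ s, hence γn ≤ 4s, against 6s < γn. -/

/-! ### Turning of polygonal paths around the origin -/

open InnerProductGeometry in
/-- The unoriented angle between two complex numbers, with the convention that it vanishes
between `0` and `0`. -/
noncomputable def turn (x y : ℂ) : ℝ :=
  open Classical in if x = 0 ∧ y = 0 then 0 else angle x y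

namespace turn

open InnerProductGeometry

theorem of_ne_zero_left {x : ℂ} (hx : x ≠ 0) (y : ℂ) : turn x y = angle x y := by
  simp [turn, hx]

theorem of_ne_zero_right {y : ℂ} (x : ℂ) (hy : y ≠ 0) : turn x y = angle x y := by
  simp [turn, hy]

theorem le_angle (x y : ℂ) : turn x y ≤ angle x y := by
  unfold turn
  split_ifs
  · exact angle_nonneg x y
  · exact le_rfl

theorem nonneg (x y : ℂ) : 0 ≤ turn x y := by
  unfold turn
  split_ifs
  · exact le_rfl
  · exact angle_nonneg x y

@[simp] theorem self (x : ℂ) : turn x x = 0 := by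
  by_cases hx : x = 0
  · simp [turn, hx]
  · rw [of_ne_zero_left hx, angle_self hx]

/-- If `y` and `z` both vanish, the two outer angles coincide, so the last term can be `turn`. In
the Rolle inequality `y` and `z` are consecutive edges, which may both be zero. -/
theorem angle_le_angle_add (x y z : ℂ) : angle x z ≤ angle x y + turn y z := by
  by_cases h : y = 0 ∧ z = 0
  · simp [turn, h.1, h.2]
  · rw [turn, if_neg h]
    exact angle_le_angle_add_angle x y z

theorem triangle (x y z : ℂ) : turn x z ≤ turn x y + turn y z := by
  by_cases h : x = 0 ∧ y = 0
  · simp [turn, h.1, h.2]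
  · rw [turn.eq_1 x y, if_neg h]
    exact (le_angle x z).trans (angle_le_angle_add x y z)

/-- The exterior angle theorem for the triangle with vertices `0`, `x`, `y`. -/
theorem le_angle_sub_angle (x y : ℂ) :
    turn x y ≤ angle x (y - x) - angle y (y - x) := by
  by_cases hy : y = 0
  · by_cases hx : x = 0
    · simp [turn, hx, hy]
    -- With the convention `angle 0 z = π / 2` this degenerate case is the equality π/2 = π - π/2.
    · simp only [hy, zero_sub, angle_zero_left, of_ne_zero_left hx, angle_zero_right,
        angle_self_neg_of_nonzero hx]
      linarith
  · have h := angle_add_angle_sub_add_angle_sub_eq_pi x hy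
    rw [← neg_sub y x, angle_neg_right] at h
    rw [of_ne_zero_right x hy]
    linarith

/-- A discrete Rolle inequality: the total turning of a polygonal path around the origin
exceeds the total turning of its edges by at most `π`. -/
theorem sum_le_pi_add_sum_sub (f : ℕ → ℂ) (n : ℕ) :
    ∑ i ∈ Finset.range n, turn (f i) (f (i + 1)) ≤
      Real.pi + ∑ i ∈ Finset.range n, turn (f (i + 1) - f i) (f (i + 1 + 1) - f (i + 1)) := by
  -- Keeping the angle between the last vertex and its outgoing edge makes the exterior angles
  -- telescope; replacing an edge by the next one costs the turn between them.
  have key : ∑ i ∈ Finset.range n, turn (f i) (f (i + 1)) ≤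
      angle (f 0) (f 1 - f 0) - angle (f n) (f (n + 1) - f n) +
        ∑ i ∈ Finset.range n, turn (f (i + 1) - f i) (f (i + 1 + 1) - f (i + 1)) := by
    induction n with
    | zero => simp
    | succ n ih =>
      rw [Finset.sum_range_succ, Finset.sum_range_succ]
      have h1 := le_angle_sub_angle (f n) (f (n + 1))
      have h2 := angle_le_angle_add (f (n + 1)) (f (n + 1) - f n) (f (n + 1 + 1) - f (n + 1))
      linarith
  linarith [angle_le_pi (f 0) (f 1 - f 0), angle_nonneg (f n) (f (n + 1) - f n)]

theorem angle_exp_exp_le (x y : ℝ) :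
    angle (Complex.exp (x * Complex.I)) (Complex.exp (y * Complex.I)) ≤ |x - y| := by
  rcases le_or_gt Real.pi |x - y| with h | h
  · exact (angle_le_pi _ _).trans h
  · rw [Complex.angle_exp_exp, (toIocMod_eq_self _).2]
    rw [abs_lt] at h
    constructor <;> linarith

/-- A common rotation changes no angle, so only the relative rotation counts. -/
theorem mul_exp_le (x y : ℂ) (a b : ℝ) :
    turn (x * Complex.exp (a * Complex.I)) (y * Complex.exp (b * Complex.I)) ≤
      turn x y + |a - b| := by
  by_cases h : x = 0 ∧ y = 0
  · simp [h.1, h.2]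
  rw [turn.eq_1 x y, if_neg h]
  have hxy : angle (x * Complex.exp (a * Complex.I)) (y * Complex.exp (a * Complex.I)) =
      angle x y := Complex.angle_mul_right (Complex.exp_ne_zero _) x y
  by_cases hy : y = 0
  · refine (le_angle _ _).trans ?_
    simp [hy]
  · refine (le_angle _ _).trans ((angle_le_angle_add_angle _
      (y * Complex.exp (a * Complex.I)) _).trans ?_)
    rw [hxy, Complex.angle_mul_left hy]
    gcongr
    exact angle_exp_exp_le a b

/-- The total turning of an exponential sum with frequencies in `[lo, hi]`, sampled on a uniform
grid of step `h`. -/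
theorem sum_expSum_le {h : ℝ} (hh : 0 ≤ h) (n : ℕ) (hi : ℝ) :
    ∀ (T : Finset ℝ) (lo : ℝ) (c : ℝ → ℂ), T.Nonempty → (∀ t ∈ T, lo ≤ t ∧ t ≤ hi) →
    ∑ i ∈ Finset.range n,
      turn (∑ t ∈ T, c t * Complex.exp (((t - lo) * (h * i) : ℝ) * Complex.I))
        (∑ t ∈ T, c t * Complex.exp (((t - lo) * (h * (i + 1 : ℕ)) : ℝ) * Complex.I)) ≤
      (T.card - 1) * Real.pi + n * h * (hi - lo) := by
  intro T
  -- Factoring out the smallest frequency `t₀` costs `h * (t₀ - lo)` of turning per step and makes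
  -- its term constant. Differences kill that term, so Rolle removes one frequency for a cost of π.
  -- The induction varies `lo` and `c` because both change at each stage.
  induction T using Finset.induction_on_min with
  | empty => intro _ _ h; exact absurd h (by simp)
  | insert t₀ T hT ih =>
    intro lo c _ hc
    have ht₀ : t₀ ∉ T := fun hm => lt_irrefl _ (hT t₀ hm)
    obtain ⟨hlo, hhi⟩ := hc t₀ (by simp)
    set F : ℕ → ℂ := fun i => ∑ t ∈ insert t₀ T,
      c t * Complex.exp (((t - t₀) * (h * i) : ℝ) * Complex.I) with hF
    have hrot : ∀ i : ℕ, ∑ t ∈ insert t₀ T,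
        c t * Complex.exp (((t - lo) * (h * i) : ℝ) * Complex.I) =
        F i * Complex.exp (((t₀ - lo) * (h * i) : ℝ) * Complex.I) := by
      intro i
      rw [hF, Finset.sum_mul]
      refine Finset.sum_congr rfl fun t _ => ?_
      rw [mul_assoc, ← Complex.exp_add]
      congr 2
      push_cast
      ring
    have hstep : ∀ i : ℕ, turn
        (∑ t ∈ insert t₀ T, c t * Complex.exp (((t - lo) * (h * i) : ℝ) * Complex.I))
        (∑ t ∈ insert t₀ T, c t * Complex.exp (((t - lo) * (h * (i + 1 : ℕ)) : ℝ) * Complex.I)) ≤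
        turn (F i) (F (i + 1)) + h * (t₀ - lo) := by
      intro i
      rw [hrot, hrot]
      refine (mul_exp_le _ _ _ _).trans_eq ?_
      rw [abs_sub_comm, abs_of_nonneg]
      · push_cast; ring
      · push_cast
        have := mul_nonneg hh (sub_nonneg.2 hlo)
        linarith
    have hconst : ∀ i : ℕ, F i = c t₀ +
        ∑ t ∈ T, c t * Complex.exp (((t - t₀) * (h * i) : ℝ) * Complex.I) := by
      intro i
      rw [hF]
      simp [Finset.sum_insert ht₀]
    have hmain : ∑ i ∈ Finset.range n, turn (F i) (F (i + 1)) ≤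
        T.card * Real.pi + n * h * (hi - t₀) := by
      rcases T.eq_empty_or_nonempty with rfl | hne
      · simp only [hconst, Finset.sum_empty, self, Finset.card_empty, Finset.sum_const_zero]
        have := mul_nonneg (mul_nonneg n.cast_nonneg hh) (sub_nonneg.2 hhi)
        simpa using this
      · have hIH := ih t₀ (fun t => c t *
          (Complex.exp (((t - t₀) * h : ℝ) * Complex.I) - 1)) hne
          fun t ht => ⟨(hT t ht).le, (hc t (by simp [ht])).2⟩
        have hd : ∀ i : ℕ, F (i + 1) - F i = ∑ t ∈ T, c t *
            (Complex.exp (((t - t₀) * h : ℝ) * Complex.I) - 1) *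
              Complex.exp (((t - t₀) * (h * i) : ℝ) * Complex.I) := by
          intro i
          rw [hconst, hconst, add_sub_add_left_eq_sub, ← Finset.sum_sub_distrib]
          refine Finset.sum_congr rfl fun t _ => ?_
          have he : Complex.exp (((t - t₀) * (h * (i + 1 : ℕ)) : ℝ) * Complex.I) =
              Complex.exp (((t - t₀) * h : ℝ) * Complex.I) *
                Complex.exp (((t - t₀) * (h * i) : ℝ) * Complex.I) := by
            rw [← Complex.exp_add]
            congr 1
            push_cast
            ring
          rw [he]
          ring
        have hR := sum_le_pi_add_sum_sub F n
        simp only [hd] at hR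
        linarith
    calc _ ≤ ∑ i ∈ Finset.range n, (turn (F i) (F (i + 1)) + h * (t₀ - lo)) :=
          Finset.sum_le_sum fun i _ => hstep i
      _ ≤ _ := by
          rw [Finset.sum_add_distrib, Finset.card_insert_of_notMem ht₀]
          simp only [Finset.sum_const, Finset.card_range, nsmul_eq_mul]
          push_cast
          linarith

end turn

/-! ### Real zeros of exponential sums -/

/-- The exponential sum `z ↦ ∑ t ∈ T, c t * exp (i t z)`. -/
noncomputable def expSum (T : Finset ℝ) (c : ℝ → ℂ) (z : ℂ) : ℂ :=
  ∑ t ∈ T, c t * Complex.exp (t * z * Complex.I)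

theorem continuous_expSum (T : Finset ℝ) (c : ℝ → ℂ) : Continuous (expSum T c) := by
  unfold expSum
  fun_prop

theorem differentiable_expSum (T : Finset ℝ) (c : ℝ → ℂ) : Differentiable ℂ (expSum T c) := by
  unfold expSum
  fun_prop

theorem expSum_add (T : Finset ℝ) (c : ℝ → ℂ) (z w : ℂ) :
    expSum T c (w + z) = expSum T (fun t => c t * Complex.exp (t * z * Complex.I)) w := by
  unfold expSum
  refine Finset.sum_congr rfl fun t _ => ?_
  rw [mul_assoc (c t), ← Complex.exp_add]
  ring_nf

/-- A monotone function increases over a family of ordered intervals by at most its increase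
over an interval containing them all. -/
theorem Monotone.sum_sub_le {A : ℝ → ℝ} (hA : Monotone A) (a b : ℝ → ℝ) (x₀ : ℝ)
    (S : Finset ℝ) : ∀ x₁ : ℝ, x₀ ≤ x₁ → (∀ w ∈ S, x₀ ≤ a w ∧ a w ≤ b w ∧ b w ≤ x₁) →
      (∀ w ∈ S, ∀ w' ∈ S, w < w' → b w ≤ a w') →
      ∑ w ∈ S, (A (b w) - A (a w)) ≤ A x₁ - A x₀ := by
  induction S using Finset.induction_on_max with
  | empty => intro x₁ h _ _; simpa using hA h
  | insert m S hm ih =>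
    intro x₁ _ h hord
    rw [Finset.sum_insert fun hmem => lt_irrefl _ (hm m hmem)]
    obtain ⟨h1, h2, h3⟩ := h m (by simp)
    have h4 := ih (a m) h1
      (fun w hw => ⟨(h w (by simp [hw])).1, (h w (by simp [hw])).2.1,
        hord w (by simp [hw]) m (by simp) (hm w hw)⟩)
      (fun w hw w' hw' => hord w (by simp [hw]) w' (by simp [hw']))
    linarith [hA h3]

/-- The turning of a sequence between two indices is at most the total
turning on the steps in between. -/
theorem turn.le_sum_sub_sum (f : ℕ → ℂ) {i j : ℕ} (hij : i ≤ j) :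
    turn (f i) (f j) ≤ ∑ k ∈ Finset.range j, turn (f k) (f (k + 1)) -
      ∑ k ∈ Finset.range i, turn (f k) (f (k + 1)) := by
  induction j, hij using Nat.le_induction with
  | base => simp
  | succ j _ ih =>
    rw [Finset.sum_range_succ]
    linarith [turn.triangle (f i) (f j) (f (j + 1))]

open Filter Topology InnerProductGeometry in
/-- The total turning of an exponential sum over disjoint intervals contained in `[x₀, x₁]`. -/
theorem sum_angle_expSum_le {T : Finset ℝ} (hT : T.Nonempty) {L : ℝ} (hL : 0 ≤ L)
    (hTL : ∀ t ∈ T, 0 ≤ t ∧ t ≤ L) (c : ℝ → ℂ) (S : Finset ℝ) (a b : ℝ → ℝ) {x₀ x₁ : ℝ}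
    (hx : x₀ ≤ x₁) (hab : ∀ w ∈ S, x₀ ≤ a w ∧ a w ≤ b w ∧ b w ≤ x₁)
    (hord : ∀ w ∈ S, ∀ w' ∈ S, w < w' → b w ≤ a w')
    (ha : ∀ w ∈ S, expSum T c (a w) ≠ 0) (hb : ∀ w ∈ S, expSum T c (b w) ≠ 0) :
    ∑ w ∈ S, angle (expSum T c (a w)) (expSum T c (b w)) ≤
      (T.card - 1) * Real.pi + L * (x₁ - x₀) := by
  -- Endpoints are rounded down to the grid of step 1/K based at `x₀`; then K tends to infinity.
  -- Angles converge because the sum does not vanish at the endpoints.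
  let r : ℝ → ℝ → ℝ := fun K y => x₀ + (⌊(y - x₀) * K⌋₊ : ℝ) / K
  have hr : ∀ y, x₀ ≤ y → Tendsto (fun K => r K y) atTop (𝓝 y) := by
    intro y hy
    have := (tendsto_nat_floor_mul_div_atTop (R := ℝ) (sub_nonneg.2 hy)).const_add x₀
    simpa [r] using this
  have hE : ∀ y, x₀ ≤ y →
      Tendsto (fun K => expSum T c (r K y)) atTop (𝓝 (expSum T c y)) := by
    intro y hy
    exact ((continuous_expSum T c).tendsto _).comp
      ((Complex.continuous_ofReal.tendsto y).comp (hr y hy))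
  have hlim : Tendsto (fun K => ∑ w ∈ S, turn (expSum T c (r K (a w))) (expSum T c (r K (b w))))
      atTop (𝓝 (∑ w ∈ S, angle (expSum T c (a w)) (expSum T c (b w)))) := by
    refine tendsto_finsetSum _ fun w hw => ?_
    have h1 := hE (a w) (hab w hw).1
    have h2 := hE (b w) ((hab w hw).1.trans (hab w hw).2.1)
    have h3 := (continuousAt_angle (x := (expSum T c (a w), expSum T c (b w)))
      (ha w hw) (hb w hw)).tendsto.comp (h1.prodMk_nhds h2)
    refine h3.congr' ?_
    filter_upwards [h1.eventually_ne (ha w hw)] with K hK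
    simp [turn.of_ne_zero_left hK]
  refine le_of_tendsto hlim ?_
  filter_upwards [eventually_gt_atTop 0] with K hK
  let f : ℕ → ℂ := fun i => expSum T c ((x₀ + (i : ℝ) / K : ℝ))
  -- Cumulative turning is monotone, so the disjoint intervals together turn no more than the whole
  -- of [x₀, x₁].
  let A : ℝ → ℝ := fun y => ∑ i ∈ Finset.range ⌊(y - x₀) * K⌋₊, turn (f i) (f (i + 1))
  have hmono : ∀ {y y'}, y ≤ y' → ⌊(y - x₀) * K⌋₊ ≤ ⌊(y' - x₀) * K⌋₊ := by
    intro y y' h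
    gcongr
  have hA : Monotone A := by
    intro y y' h
    refine Finset.sum_le_sum_of_subset_of_nonneg ?_ fun _ _ _ => turn.nonneg _ _
    exact Finset.range_subset_range.2 (hmono h)
  have h1 : ∑ w ∈ S, turn (expSum T c (r K (a w))) (expSum T c (r K (b w))) ≤
      ∑ w ∈ S, (A (b w) - A (a w)) :=
    Finset.sum_le_sum fun w hw => turn.le_sum_sub_sum f (hmono (hab w hw).2.1)
  have h2 := hA.sum_sub_le a b x₀ S x₁ hx hab hord
  have h3 : A x₀ = 0 := by simp [A]
  have h4 : A x₁ ≤ (T.card - 1) * Real.pi + ⌊(x₁ - x₀) * K⌋₊ * K⁻¹ * (L - 0) := by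
    have := turn.sum_expSum_le (inv_nonneg.2 hK.le) ⌊(x₁ - x₀) * K⌋₊ L T 0
      (fun t => c t * Complex.exp (t * x₀ * Complex.I)) hT hTL
    refine le_trans (le_of_eq ?_) this
    have hf : ∀ i, f i = ∑ t ∈ T, c t * Complex.exp (t * x₀ * Complex.I) *
        Complex.exp (((t - 0) * (K⁻¹ * i) : ℝ) * Complex.I) := by
      intro i
      refine Finset.sum_congr rfl fun t _ => ?_
      rw [mul_assoc (c t), ← Complex.exp_add]
      congr 2
      push_cast
      ring
    simp only [A, hf]
  have h5 : (⌊(x₁ - x₀) * K⌋₊ : ℝ) * K⁻¹ ≤ x₁ - x₀ := by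
    rw [← div_eq_mul_inv, div_le_iff₀ hK]
    exact Nat.floor_le (mul_nonneg (sub_nonneg.2 hx) hK.le)
  have h6 := mul_le_mul_of_nonneg_right h5 hL
  linarith

open InnerProductGeometry in
/-- Two points on the horizontal line through `i` whose `p`-th powers are almost opposite. -/
theorem exists_angle_pow_eq {p : ℕ} (hp : p ≠ 0) {δ : ℝ} (hδ : 0 < δ) (hδ' : δ < Real.pi / 2) :
    ∃ X Y : ℝ, X ≤ Y ∧
      angle (((X : ℂ) + Complex.I) ^ p) (((Y : ℂ) + Complex.I) ^ p) = Real.pi - 2 * δ := by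
  have hp1 : (1 : ℝ) ≤ p := by exact_mod_cast Nat.one_le_iff_ne_zero.2 hp
  have hp0 : (0 : ℝ) < p := by linarith
  -- The point of the line Im = 1 with argument θ is cot θ + i.
  have key : ∀ θ : ℝ, Real.sin θ ≠ 0 → ((Real.cos θ / Real.sin θ : ℝ) : ℂ) + Complex.I =
      ((Real.sin θ)⁻¹ : ℝ) * Complex.exp (θ * Complex.I) := by
    intro θ hθ
    have : (Complex.sin θ) ≠ 0 := by exact_mod_cast hθ
    rw [Complex.exp_mul_I]
    push_cast
    field_simp
  have hs : ∀ φ : ℝ, 0 < φ → φ < Real.pi → 0 < Real.sin (φ / p) := by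
    intro φ h1 h2
    refine Real.sin_pos_of_pos_of_lt_pi (by positivity) ?_
    exact (div_le_self h1.le hp1).trans_lt h2
  have hs1 := hs δ hδ (by linarith)
  have hs2 := hs (Real.pi - δ) (by linarith) (by linarith)
  -- The arguments (π - δ)/p and δ/p become π - δ and δ after taking p-th powers. Positive δ keeps
  -- both points at finite distance, also for p = 1.
  refine ⟨Real.cos ((Real.pi - δ) / p) / Real.sin ((Real.pi - δ) / p),
    Real.cos (δ / p) / Real.sin (δ / p), ?_, ?_⟩
  · rw [div_le_div_iff₀ hs2 hs1]
    have h3 : 0 ≤ Real.sin ((Real.pi - δ) / p - δ / p) := by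
      rw [← sub_div]
      exact (hs _ (by linarith) (by linarith)).le
    rw [Real.sin_sub] at h3
    linarith
  · rw [key _ hs1.ne', key _ hs2.ne', mul_pow, mul_pow, ← Complex.exp_nat_mul,
      ← Complex.exp_nat_mul, ← Complex.ofReal_pow, ← Complex.ofReal_pow,
      ← Complex.real_smul (x := _ ^ p), ← Complex.real_smul (x := _ ^ p), angle_smul_left_of_pos _ _ (by positivity),
      angle_smul_right_of_pos _ _ (by positivity)]
    have h4 : ∀ φ : ℝ, (p : ℂ) * ((φ / p : ℝ) * Complex.I) = φ * Complex.I := by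
      intro φ
      have : (p : ℂ) ≠ 0 := by exact_mod_cast hp
      push_cast
      field_simp
    rw [h4, h4, Complex.angle_exp_exp, (toIocMod_eq_self _).2, abs_of_nonneg]
    · ring
    · linarith
    · constructor <;> linarith

open Filter Topology InnerProductGeometry in
/-- At a zero of an analytic function, the function takes almost opposite directions at
suitable points of horizontal lines approaching the zero from above. -/
theorem AnalyticAt.exists_tendsto_angle {f : ℂ → ℂ} {z : ℂ} (hf : AnalyticAt ℂ f z)
    (hz : f z = 0) (hne : ¬ ∀ᶠ w in 𝓝 z, f w = 0) {δ : ℝ} (hδ : 0 < δ)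
    (hδ' : δ < Real.pi / 2) :
    ∃ X Y : ℝ, X ≤ Y ∧
      (∀ᶠ τ : ℝ in 𝓝[>] 0, f (z + τ * (X + Complex.I)) ≠ 0) ∧
      (∀ᶠ τ : ℝ in 𝓝[>] 0, f (z + τ * (Y + Complex.I)) ≠ 0) ∧
      Tendsto (fun τ : ℝ => angle (f (z + τ * (X + Complex.I))) (f (z + τ * (Y + Complex.I))))
        (𝓝[>] 0) (𝓝 (Real.pi - 2 * δ)) := by
  obtain ⟨p, g, hg, hg0, hfg⟩ := hf.exists_eventuallyEq_pow_smul_nonzero_iff.2 hne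
  have hp : p ≠ 0 := by
    rintro rfl
    have := hfg.self_of_nhds
    simp [hz] at this
    exact hg0 this.symm
  obtain ⟨X, Y, hXY, hang⟩ := exists_angle_pow_eq hp hδ hδ'
  have hto : ∀ x : ℝ, Tendsto (fun τ : ℝ => z + τ * ((x : ℂ) + Complex.I)) (𝓝[>] 0) (𝓝 z) := by
    intro x
    have : Continuous fun τ : ℝ => z + τ * ((x : ℂ) + Complex.I) := by fun_prop
    have h := this.tendsto 0
    simp only [Complex.ofReal_zero, zero_mul, add_zero] at h
    exact h.mono_left nhdsWithin_le_nhds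
  have hI : ∀ x : ℝ, (x : ℂ) + Complex.I ≠ 0 := by
    intro x h
    simpa using congrArg Complex.im h
  have hgx : ∀ x : ℝ, Tendsto (fun τ : ℝ => g (z + τ * ((x : ℂ) + Complex.I))) (𝓝[>] 0)
      (𝓝 (g z)) := fun x => hg.continuousAt.tendsto.comp (hto x)
  -- Near a zero of order p, f(w) = (w - z)^p g(w). Along each ray the factor τ^p is positive and
  -- does not affect angles.
  have hform : ∀ x : ℝ, ∀ᶠ τ : ℝ in 𝓝[>] 0, 0 < τ ∧ f (z + τ * ((x : ℂ) + Complex.I)) =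
      (τ ^ p : ℝ) • (((x : ℂ) + Complex.I) ^ p * g (z + τ * ((x : ℂ) + Complex.I))) := by
    intro x
    filter_upwards [(hto x).eventually hfg, self_mem_nhdsWithin] with τ h1 h2
    refine ⟨h2, ?_⟩
    rw [h1, Complex.real_smul, add_sub_cancel_left, mul_pow, smul_eq_mul]
    push_cast
    ring
  have hnz : ∀ x : ℝ, ∀ᶠ τ : ℝ in 𝓝[>] 0, f (z + τ * ((x : ℂ) + Complex.I)) ≠ 0 := by
    intro x
    filter_upwards [hform x, (hgx x).eventually_ne hg0] with τ h1 h2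
    rw [h1.2]
    exact smul_ne_zero (pow_pos h1.1 p).ne' (mul_ne_zero (pow_ne_zero _ (hI x)) h2)
  refine ⟨X, Y, hXY, hnz X, hnz Y, ?_⟩
  have hlim := (continuousAt_angle
    (x := (((X : ℂ) + Complex.I) ^ p * g z, ((Y : ℂ) + Complex.I) ^ p * g z))
    (mul_ne_zero (pow_ne_zero _ (hI X)) hg0) (mul_ne_zero (pow_ne_zero _ (hI Y)) hg0)).tendsto.comp
      (((hgx X).const_mul (((X : ℂ) + Complex.I) ^ p)).prodMk_nhds
        ((hgx Y).const_mul (((Y : ℂ) + Complex.I) ^ p)))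
  simp only [Complex.angle_mul_right hg0, hang] at hlim
  refine hlim.congr' ?_
  filter_upwards [hform X, hform Y] with τ h1 h2
  simp only [Function.comp_apply]
  rw [h1.2, h2.2, angle_smul_smul (pow_pos h1.1 p).ne']

open Filter Topology InnerProductGeometry in
/-- A bound for the number of real zeros of an exponential sum with `T.card` frequencies
in `[0, L]`. -/
theorem card_zeros_expSum_le {T : Finset ℝ} {L : ℝ} (hL : 0 ≤ L)
    (hTL : ∀ t ∈ T, 0 ≤ t ∧ t ≤ L) (c : ℝ → ℂ) (hne : ∃ z, expSum T c z ≠ 0)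
    (S : Finset ℝ) {x₀ x₁ : ℝ} (hx : x₀ ≤ x₁) (hS : ∀ w ∈ S, x₀ ≤ w ∧ w ≤ x₁)
    (hS0 : ∀ w ∈ S, expSum T c w = 0) :
    S.card * Real.pi ≤ (T.card - 1) * Real.pi + L * (x₁ - x₀) := by
  have hT : T.Nonempty := by
    obtain ⟨z, hz⟩ := hne
    by_contra h
    rw [Finset.not_nonempty_iff_eq_empty] at h
    simp [h, expSum] at hz
  have han : AnalyticOnNhd ℂ (expSum T c) Set.univ :=
    (differentiable_expSum T c).differentiableOn.analyticOnNhd isOpen_univ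
  have hloc : ∀ w : ℂ, ¬ ∀ᶠ z in 𝓝 w, expSum T c z = 0 := by
    intro w hw
    obtain ⟨z, hz⟩ := hne
    exact hz (han.eqOn_zero_of_preconnected_of_eventuallyEq_zero isPreconnected_univ
      (Set.mem_univ w) hw (Set.mem_univ z))
  have main : ∀ δ : ℝ, 0 < δ → δ < Real.pi / 2 →
      S.card * (Real.pi - 2 * δ) ≤ (T.card - 1) * Real.pi + L * (x₁ - x₀) := by
    intro δ hδ hδ'
    choose! X Y hXY hX hY hlim using fun (w : ℝ) (hw : w ∈ S) =>
      (han (w : ℂ) (Set.mem_univ _)).exists_tendsto_angle (hS0 w hw) (hloc w) hδ hδ'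
    -- `τ * M` bounds every horizontal displacement, so the short intervals near the zeros lie in
    -- [x₀ - τM, x₁ + τM], which shrinks to [x₀, x₁].
    set M : ℝ := ∑ w ∈ S, (|X w| + |Y w|) with hM
    have hMw : ∀ w ∈ S, |X w| + |Y w| ≤ M := fun w hw =>
      Finset.single_le_sum (f := fun w => |X w| + |Y w|) (fun _ _ => by positivity) hw
    have hM0 : 0 ≤ M := Finset.sum_nonneg fun _ _ => by positivity
    have hsum : Tendsto (fun τ : ℝ => ∑ w ∈ S,
        angle (expSum T c (w + τ * (X w + Complex.I))) (expSum T c (w + τ * (Y w + Complex.I))))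
        (𝓝[>] 0) (𝓝 (S.card * (Real.pi - 2 * δ))) := by
      have := tendsto_finsetSum S fun w hw => hlim w hw
      rwa [Finset.sum_const, nsmul_eq_mul] at this
    have hrhs : Tendsto (fun τ : ℝ => (T.card - 1) * Real.pi + L * (x₁ + τ * M - (x₀ - τ * M)))
        (𝓝[>] 0) (𝓝 ((T.card - 1) * Real.pi + L * (x₁ - x₀))) := by
      have hcont : Continuous fun τ : ℝ =>
          (T.card - 1) * Real.pi + L * (x₁ + τ * M - (x₀ - τ * M)) := by fun_prop
      have h := hcont.tendsto 0
      simp only [zero_mul, add_zero, sub_zero] at h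
      exact h.mono_left nhdsWithin_le_nhds
    refine le_of_tendsto_of_tendsto hsum hrhs ?_
    have hord : ∀ᶠ τ : ℝ in 𝓝[>] 0, ∀ w ∈ S, ∀ w' ∈ S, w < w' →
        w + τ * Y w ≤ w' + τ * X w' := by
      refine (Finset.eventually_all S).2 fun w _ => (Finset.eventually_all S).2 fun w' _ => ?_
      by_cases hww : w < w'
      · have hcont : Continuous fun τ : ℝ => w' + τ * X w' - (w + τ * Y w) := by fun_prop
        have h := (hcont.tendsto 0).mono_left (nhdsWithin_le_nhds (s := Set.Ioi 0))
        simp only [zero_mul, add_zero] at h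
        filter_upwards [h.eventually_const_lt (sub_pos.2 hww)] with τ hτ _
        linarith
      · exact Eventually.of_forall fun _ h => absurd h hww
    filter_upwards [hord, (Finset.eventually_all S).2 hX, (Finset.eventually_all S).2 hY,
      self_mem_nhdsWithin] with τ ho h1 h2 hτ
    have hτ0 : (0 : ℝ) < τ := hτ
    -- Moving up by iτ only changes the coefficients, so the turning bound for the real line
    -- applies.
    have hshift : ∀ w x : ℝ, expSum T c (w + τ * (x + Complex.I)) =
        expSum T (fun t => c t * Complex.exp (t * (τ * Complex.I) * Complex.I))
          ((w + τ * x : ℝ)) := by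
      intro w x
      rw [← expSum_add]
      congr 1
      push_cast
      ring
    simp only [hshift] at h1 h2 ⊢
    have hMτ : 0 ≤ τ * M := by positivity
    refine sum_angle_expSum_le hT hL hTL _ S (fun w => w + τ * X w) (fun w => w + τ * Y w)
      (by linarith) (fun w hw => ⟨?_, ?_, ?_⟩) ho h1 h2
    · have h3 : -M ≤ X w := by
        linarith [hMw w hw, neg_abs_le (X w), abs_nonneg (Y w)]
      have := mul_le_mul_of_nonneg_left h3 hτ0.le
      linarith [(hS w hw).1]
    · have := mul_le_mul_of_nonneg_left (hXY w hw) hτ0.le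
      linarith
    · have h3 : Y w ≤ M := by
        linarith [hMw w hw, le_abs_self (Y w), abs_nonneg (X w)]
      have := mul_le_mul_of_nonneg_left h3 hτ0.le
      linarith [(hS w hw).2]
  have hlim : Tendsto (fun δ : ℝ => S.card * (Real.pi - 2 * δ)) (𝓝[>] 0)
      (𝓝 (S.card * Real.pi)) := by
    have hcont : Continuous fun δ : ℝ => S.card * (Real.pi - 2 * δ) := by fun_prop
    have h := hcont.tendsto 0
    simp only [mul_zero, sub_zero] at h
    exact h.mono_left nhdsWithin_le_nhds
  refine le_of_tendsto hlim ?_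
  filter_upwards [self_mem_nhdsWithin,
    mem_nhdsWithin_of_mem_nhds (Iio_mem_nhds (show (0 : ℝ) < Real.pi / 2 by positivity))]
    with δ h1 h2
  exact main δ h1 h2

/-! ### Spectral gap and vertex deletion -/

section Graph

variable {V : Type*} [Fintype V] [DecidableEq V] {G : SimpleGraph V} [DecidableRel G.Adj]

/-- A nonzero eigenvalue of the Laplacian matrix of a `d`-regular graph is at least `d` times the
normalized spectral gap. -/
theorem mul_spectralGap_le_of_lapMatrix_mulVec {d : ℕ} (hd : 0 < d)
    (hreg : G.IsRegularOfDegree d) {x : V → ℝ} (hx : x ≠ 0) {l : ℝ} (hl : l ≠ 0)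
    (h : (G.lapMatrix ℝ).mulVec x = l • x) : d * spectralGap G ≤ l := by
  have hd' : (0 : ℝ) < d := by exact_mod_cast hd
  have hdC : (d : ℂ) ≠ 0 := by exact_mod_cast hd.ne'
  -- An infimum in `ℝ` bounds its set only if the set is bounded below; here the spectrum is finite.
  have hbdd : BddBelow {l : ℝ | l ≠ 0 ∧
      Module.End.HasEigenvalue (normalizedLaplacian G) (l : ℂ)} := by
    refine Set.Finite.bddBelow (Set.Finite.subset
      ((Module.End.finite_hasEigenvalue (normalizedLaplacian G)).preimage
        Complex.ofReal_injective.injOn) ?_)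
    exact fun l hl => hl.2
  have hle : spectralGap G ≤ l / d := by
    refine csInf_le hbdd ⟨by positivity, ?_⟩
    refine Module.End.hasEigenvalue_of_hasEigenvector (x := fun v => (x v : ℂ)) ⟨?_, ?_⟩
    · rw [Module.End.mem_eigenspace_iff]
      ext v
      have hv := congrFun h v
      rw [SimpleGraph.lapMatrix_mulVec_apply, hreg v] at hv
      have hv' : (d : ℂ) * x v - ∑ u ∈ G.neighborFinset v, (x u : ℂ) = l * x v := by
        exact_mod_cast congrArg (fun r : ℝ => (r : ℂ)) hv
      simp only [normalizedLaplacian, LinearMap.coe_mk, AddHom.coe_mk, Pi.smul_apply, smul_eq_mul,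
        hreg v]
      push_cast
      field_simp
      linear_combination hv'
    · intro h0
      refine hx (funext fun v => ?_)
      have := congrFun h0 v
      simpa using this
  rw [le_div_iff₀ hd'] at hle
  linarith

/-- The Poincaré inequality for a regular connected graph. -/
theorem poincare_of_le_spectralGap {d : ℕ} (hd : 0 < d) (hreg : G.IsRegularOfDegree d)
    (hconn : G.Connected) {g : ℝ} (hg : g ≤ spectralGap G) {x : V → ℝ} (hx : ∑ v, x v = 0) :
    d * g * ∑ v, x v ^ 2 ≤ (∑ i, ∑ j, if G.Adj i j then (x i - x j) ^ 2 else 0) / 2 := by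
  have hd' : (0 : ℝ) < d := by exact_mod_cast hd
  have hH := G.isHermitian_lapMatrix ℝ
  let b := hH.eigenvectorBasis
  let β : V → V → ℝ := fun i => ⇑(b i)
  have hP : ∀ y z : V → ℝ, ∑ i, (β i ⬝ᵥ y) * (β i ⬝ᵥ z) = y ⬝ᵥ z := by
    intro y z
    have := b.sum_inner_mul_inner (WithLp.toLp 2 y) (WithLp.toLp 2 z)
    simp only [EuclideanSpace.inner_eq_star_dotProduct, star_trivial] at this
    rw [dotProduct_comm y z, ← this]
    refine Finset.sum_congr rfl fun i _ => ?_
    rw [dotProduct_comm z]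
  have hmul : ∀ i, (G.lapMatrix ℝ).mulVec (β i) = hH.eigenvalues i • β i :=
    hH.mulVec_eigenvectorBasis
  have hβ : ∀ i, β i ≠ 0 := by
    intro i h0
    have hn := b.orthonormal.ne_zero i
    refine hn ?_
    ext v
    exact congrFun h0 v
  have hL : ∀ i, β i ⬝ᵥ (G.lapMatrix ℝ).mulVec x = hH.eigenvalues i * (β i ⬝ᵥ x) := by
    intro i
    rw [Matrix.dotProduct_mulVec, ← Matrix.mulVec_transpose, (G.isSymm_lapMatrix ℝ).eq, hmul,
      smul_dotProduct, smul_eq_mul]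
  have hD : (∑ i, ∑ j, if G.Adj i j then (x i - x j) ^ 2 else 0) / 2 =
      ∑ i, hH.eigenvalues i * (β i ⬝ᵥ x) ^ 2 := by
    rw [← G.lapMatrix_toLinearMap₂' ℝ x, Matrix.toLinearMap₂'_apply', ← hP]
    refine Finset.sum_congr rfl fun i _ => ?_
    rw [hL]
    ring
  have hN : ∑ v, x v ^ 2 = ∑ i, (β i ⬝ᵥ x) ^ 2 := by
    have := hP x x
    simp only [← sq] at this
    rw [this]
    simp [dotProduct, sq]
  rw [hD, hN, Finset.mul_sum]
  refine Finset.sum_le_sum fun i _ => ?_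
  -- By connectedness, a null eigenvector is constant, hence orthogonal to the mean-zero `x`. All
  -- other eigenvalues are at least `d * g`.
  by_cases h0 : hH.eigenvalues i = 0
  · have hker : (G.lapMatrix ℝ).mulVec (β i) = 0 := by rw [hmul, h0, zero_smul]
    have hconst := (G.lapMatrix_mulVec_eq_zero_iff_forall_reachable).1 hker
    obtain ⟨v₀⟩ := hconn.nonempty
    have hz : β i ⬝ᵥ x = 0 := by
      have : ∀ v, β i v = β i v₀ := fun v => hconst v v₀ (hconn.preconnected v v₀)
      simp only [dotProduct, this]
      rw [← Finset.mul_sum, hx, mul_zero]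
    simp [hz]
  · have h1 := mul_spectralGap_le_of_lapMatrix_mulVec hd hreg (hβ i) h0 (hmul i)
    have h2 := mul_le_mul_of_nonneg_left hg hd'.le
    gcongr
    linarith

/-- Edge expansion of a regular connected graph: the edge boundary of a set of vertices, as the
Dirichlet form of its indicator function. -/
theorem card_mul_le_dirichlet {d : ℕ} (hd : 0 < d) (hreg : G.IsRegularOfDegree d)
    (hconn : G.Connected) {g : ℝ} (hg : g ≤ spectralGap G) (C : Finset V) :
    d * g * (C.card * (1 - C.card / Fintype.card V)) ≤
      (∑ i, ∑ j, if G.Adj i j then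
        ((if i ∈ C then (1 : ℝ) else 0) - if j ∈ C then 1 else 0) ^ 2 else 0) / 2 := by
  obtain ⟨v₀⟩ := hconn.nonempty
  have hcard : (Fintype.card V : ℝ) ≠ 0 := by
    exact_mod_cast (Fintype.card_pos_iff.2 ⟨v₀⟩).ne'
  set m : ℝ := C.card / Fintype.card V with hm
  have hmc : m * Fintype.card V = C.card := by rw [hm]; field_simp
  -- Subtracting the mean leaves the Dirichlet form unchanged and makes the Poincaré inequality
  -- applicable.
  let x : V → ℝ := fun v => (if v ∈ C then (1 : ℝ) else 0) - m
  have hx : ∑ v, x v = 0 := by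
    simp only [x, Finset.sum_sub_distrib, Finset.sum_const, Finset.card_univ, nsmul_eq_mul]
    simp
    linarith
  have hsq : ∑ v, x v ^ 2 = C.card * (1 - m) := by
    have : ∀ v, x v ^ 2 = (1 - 2 * m) * (if v ∈ C then (1 : ℝ) else 0) + m ^ 2 := by
      intro v
      simp only [x]
      split_ifs <;> ring
    simp only [this, Finset.sum_add_distrib, ← Finset.mul_sum, Finset.sum_const, Finset.card_univ,
      nsmul_eq_mul]
    simp
    linear_combination m * hmc
  have := poincare_of_le_spectralGap hd hreg hconn hg hx
  rw [hsq] at this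
  simpa only [x, sub_sub_sub_cancel_right] using this

/-- If the graph minus `Z` carries a locally constant function all of whose level sets have at
most `B` elements, then `Z` is large. -/
theorem card_le_of_level_sets_le {α : Type*} [DecidableEq α] {d : ℕ} (hd : 0 < d)
    (hreg : G.IsRegularOfDegree d) (hconn : G.Connected) {g : ℝ} (hg0 : 0 ≤ g)
    (hg : g ≤ spectralGap G) (Z : Finset V) (u : V → α)
    (hu : ∀ i j, G.Adj i j → i ∉ Z → j ∉ Z → u i = u j) {B : ℝ}
    (hB : ∀ a, ((Zᶜ.filter fun v => u v = a).card : ℝ) ≤ B) :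
    g * ((Fintype.card V - Z.card) * (1 - B / Fintype.card V)) ≤ Z.card := by
  have hd' : (0 : ℝ) < d := by exact_mod_cast hd
  obtain ⟨v₀⟩ := hconn.nonempty
  have hcard : (0 : ℝ) < Fintype.card V := by
    exact_mod_cast Fintype.card_pos_iff.2 ⟨v₀⟩
  let U : Finset α := Zᶜ.image u
  let C : α → Finset V := fun a => Zᶜ.filter fun v => u v = a
  have hsumC : ∑ a ∈ U, ((C a).card : ℝ) = Fintype.card V - Z.card := by
    have h1 : Zᶜ.card = ∑ a ∈ U, (C a).card :=
      Finset.card_eq_sum_card_fiberwise fun v hv => Finset.mem_image_of_mem u hv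
    have h2 := Finset.card_add_card_compl Z
    rw [h1] at h2
    have h3 : (Z.card : ℝ) + ∑ a ∈ U, ((C a).card : ℝ) = Fintype.card V := by exact_mod_cast h2
    linarith
  let χ : α → V → ℝ := fun a v => if v ∈ C a then 1 else 0
  have hχsum : ∀ v, ∑ a ∈ U, χ a v ^ 2 ≤ 1 := by
    intro v
    calc ∑ a ∈ U, χ a v ^ 2 ≤ ∑ a ∈ U, if a = u v then (1 : ℝ) else 0 := by
          refine Finset.sum_le_sum fun a _ => ?_
          by_cases ha : a = u v
          · simp only [χ, if_pos ha]
            split_ifs <;> norm_num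
          · have : v ∉ C a := fun h => ha (Finset.mem_filter.1 h).2.symm
            simp [χ, this, ha]
      _ ≤ 1 := by
          rw [Finset.sum_ite_eq']
          split_ifs <;> norm_num
  have hχZ : ∀ v ∈ Z, ∀ a, χ a v = 0 := by
    intro v hv a
    simp [χ, C, hv]
  -- An edge avoiding Z stays in one level set and contributes nothing. The level sets are disjoint,
  -- so any other edge contributes at most 1 for each endpoint in Z.
  have hpair : ∀ i j, G.Adj i j → ∑ a ∈ U, (χ a i - χ a j) ^ 2 ≤
      (if i ∈ Z then (1 : ℝ) else 0) + if j ∈ Z then 1 else 0 := by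
    intro i j hij
    by_cases hi : i ∈ Z
    · simp only [hχZ i hi, zero_sub, neg_sq, if_pos hi]
      have := hχsum j
      split_ifs <;> linarith
    · by_cases hj : j ∈ Z
      · simp only [hχZ j hj, sub_zero, if_pos hj]
        have := hχsum i
        split_ifs
        linarith
      · have : ∀ a, χ a i = χ a j := by
          intro a
          simp [χ, C, hi, hj, hu i j hij hi hj]
        simp [this, hi, hj]
  have hdeg : ∀ i, ∑ j, (if G.Adj i j then (1 : ℝ) else 0) = d := by
    intro i
    rw [← SimpleGraph.degree_eq_sum_if_adj, hreg i]
  have htotal : ∑ a ∈ U, ∑ i, ∑ j, (if G.Adj i j then (χ a i - χ a j) ^ 2 else 0) ≤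
      2 * (d * Z.card) := by
    calc ∑ a ∈ U, ∑ i, ∑ j, (if G.Adj i j then (χ a i - χ a j) ^ 2 else 0)
        = ∑ i, ∑ j, if G.Adj i j then ∑ a ∈ U, (χ a i - χ a j) ^ 2 else 0 := by
          rw [Finset.sum_comm]
          refine Finset.sum_congr rfl fun i _ => ?_
          rw [Finset.sum_comm]
          refine Finset.sum_congr rfl fun j _ => ?_
          split_ifs <;> simp
      _ ≤ ∑ i, ∑ j, ((if i ∈ Z then (1 : ℝ) else 0) * (if G.Adj i j then 1 else 0) +
            (if j ∈ Z then (1 : ℝ) else 0) * (if G.Adj j i then 1 else 0)) := by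
          refine Finset.sum_le_sum fun i _ => Finset.sum_le_sum fun j _ => ?_
          by_cases hij : G.Adj i j
          · simpa [hij, hij.symm] using hpair i j hij
          · have hji : ¬ G.Adj j i := fun h => hij h.symm
            simp [hij, hji]
      _ = 2 * (d * Z.card) := by
          have h1 : ∑ i, ∑ j, (if i ∈ Z then (1 : ℝ) else 0) * (if G.Adj i j then 1 else 0) =
              d * Z.card := by
            simp only [← Finset.mul_sum, hdeg, ← Finset.sum_mul]
            simp
            ring
          simp only [Finset.sum_add_distrib]
          rw [h1, Finset.sum_comm, h1]
          ring
  have hexp : ∑ a ∈ U, d * g * ((C a).card * (1 - (C a).card / Fintype.card V)) ≤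
      d * Z.card := by
    calc _ ≤ ∑ a ∈ U, (∑ i, ∑ j, if G.Adj i j then (χ a i - χ a j) ^ 2 else 0) / 2 :=
          Finset.sum_le_sum fun a _ => card_mul_le_dirichlet hd hreg hconn hg (C a)
      _ ≤ _ := by
          rw [← Finset.sum_div]
          linarith
  -- Each 1 - |C a|/|V| is at least 1 - B/|V|, and the sizes |C a| add up to |V| - |Z|.
  have hlow : d * g * ((Fintype.card V - Z.card) * (1 - B / Fintype.card V)) ≤
      ∑ a ∈ U, d * g * ((C a).card * (1 - (C a).card / Fintype.card V)) := by
    rw [← hsumC, Finset.sum_mul, Finset.mul_sum]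
    refine Finset.sum_le_sum fun a _ => ?_
    have := hB a
    gcongr
  have := hlow.trans hexp
  rw [mul_assoc] at this
  exact le_of_mul_le_mul_left this hd'

/-- The number of edges written as increasing pairs. -/
theorem two_mul_card_orderedEdge {n d : ℕ} (G : SimpleGraph (Fin n)) [DecidableRel G.Adj]
    (hreg : G.IsRegularOfDegree d) : 2 * Nat.card (OrderedEdge G) = d * n := by
  have hdeg : ∑ i, ∑ j, (if G.Adj i j then 1 else 0) = d * n := by
    simp only [← SimpleGraph.degree_eq_sum_if_adj, hreg.degree_eq]
    simp [mul_comm]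
  have hcard : Nat.card (OrderedEdge G) = ∑ i, ∑ j, (if i < j ∧ G.Adj i j then 1 else 0) := by
    rw [Nat.card_eq_fintype_card, Fintype.card_subtype, Finset.card_filter,
      ← Finset.univ_product_univ, Finset.sum_product]
  have hswap : ∑ i, ∑ j, (if i < j ∧ G.Adj i j then 1 else 0) =
      ∑ i, ∑ j, (if j < i ∧ G.Adj i j then 1 else 0) := by
    rw [Finset.sum_comm]
    simp only [G.adj_comm]
  rw [← hdeg, two_mul, hcard]
  nth_rw 2 [hswap]
  simp only [← Finset.sum_add_distrib]
  refine Finset.sum_congr rfl fun i _ => Finset.sum_congr rfl fun j _ => ?_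
  rcases lt_trichotomy i j with h | rfl | h
  · simp [h, h.not_gt]
  · simp
  · simp [h, h.not_gt]

theorem card_measurementIndex {n d : ℕ} (G : SimpleGraph (Fin n)) [DecidableRel G.Adj]
    (hreg : G.IsRegularOfDegree d) : Nat.card (MeasurementIndex G) = (d + 1) * n := by
  have h := two_mul_card_orderedEdge G hreg
  rw [Nat.card_sum, Nat.card_sum, Nat.card_fin]
  linarith

end Graph

/-! ### Dirac sums and uniqueness from zeros of the transform -/

/-- The combination `∑ t ∈ T, c t • δ_t` of Dirac measures. -/
noncomputable def diracSum (T : Finset ℝ) (c : ℝ → ℂ) : ComplexMeasure ℝ :=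
  ∑ t ∈ T, c t • VectorMeasure.dirac t (1 : ℂ)

theorem measureFourier_diracSum (T : Finset ℝ) (c : ℝ → ℂ) (ω : ℝ) :
    measureFourier (diracSum T c) ω = expSum T c ((-2 * Real.pi * ω : ℝ)) := by
  unfold measureFourier diracSum
  simp only [smul_dirac_one]
  rw [VectorMeasure.integral_finsetSum_vectorMeasure]
  · refine Finset.sum_congr rfl fun t _ => ?_
    rw [VectorMeasure.integral_dirac, ContinuousLinearMap.mul_apply', mul_comm]
    congr 2
    push_cast
    ring
  · intro j _
    rw [VectorMeasure.Integrable, VectorMeasure.variation_dirac]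
    exact (integrable_dirac (by simp)).smul_measure (by simp)

theorem diracSum_eq_of_subset {T T' : Finset ℝ} (h : T ⊆ T') {c : ℝ → ℂ}
    (hc : ∀ t ∉ T, c t = 0) : diracSum T c = diracSum T' c :=
  Finset.sum_subset h fun t _ ht => by rw [hc t ht]; exact zero_smul ℂ (_ : ComplexMeasure ℝ)

theorem diracSum_sub_smul (T : Finset ℝ) (c c' : ℝ → ℂ) (u : ℂ) :
    diracSum T c - u • diracSum T c' = diracSum T fun t => c t - u * c' t := by
  unfold diracSum
  rw [Finset.smul_sum, ← Finset.sum_sub_distrib]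
  refine Finset.sum_congr rfl fun t _ => ?_
  rw [← mul_smul]
  exact (sub_smul (c t) (u * c' t) _).symm

theorem expSum_sub_mul (T : Finset ℝ) (c c' : ℝ → ℂ) (u z : ℂ) :
    expSum T (fun t => c t - u * c' t) z = expSum T c z - u * expSum T c' z := by
  unfold expSum
  rw [Finset.mul_sum, ← Finset.sum_sub_distrib]
  refine Finset.sum_congr rfl fun t _ => ?_
  ring

theorem exists_eq_diracSum {L : ℝ} {s : ℕ} {μ : ComplexMeasure ℝ}
    (hμ : μ ∈ diracCombinations L s) : ∃ (T : Finset ℝ) (c : ℝ → ℂ), T.card ≤ s ∧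
      (∀ t ∈ T, 0 ≤ t ∧ t ≤ L) ∧ (∀ t ∉ T, c t = 0) ∧ μ = diracSum T c := by
  obtain ⟨c, t, ht, htL, rfl⟩ := hμ
  refine ⟨Finset.univ.image t, Function.extend t c 0, ?_, ?_, ?_, ?_⟩
  · exact Finset.card_image_le.trans (by simp)
  · intro x hx
    obtain ⟨j, _, rfl⟩ := Finset.mem_image.1 hx
    exact htL j
  · intro x hx
    refine Function.extend_apply' _ _ _ ?_
    rintro ⟨j, rfl⟩
    exact hx (by simp)
  · rw [diracSum, Finset.sum_image ht.injective.injOn]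
    exact Finset.sum_congr rfl fun j _ => by rw [ht.injective.extend_apply]

/-- The exponentials `x ↦ exp (i t x)` are linearly independent. -/
theorem eq_zero_of_expSum_eq_zero {T : Finset ℝ} {c : ℝ → ℂ}
    (h : ∀ x : ℝ, expSum T c x = 0) : ∀ t ∈ T, c t = 0 := by
  -- The exponentials are distinct characters of the additive group of reals, so Dedekind's
  -- independence of characters applies.
  let χ : ℝ → (Multiplicative ℝ →* ℂ) := fun t =>
    { toFun := fun x => Complex.exp (t * (Multiplicative.toAdd x : ℝ) * Complex.I)
      map_one' := by simp
      map_mul' := fun x y => by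
        rw [← Complex.exp_add, toAdd_mul]
        congr 1
        push_cast
        ring }
  have hχ : Function.Injective χ := by
    intro t t' htt
    by_contra hne
    -- At π/(t - t') the two characters differ by the factor exp(iπ) = -1.
    have h1 := DFunLike.congr_fun htt (Multiplicative.ofAdd (Real.pi / (t - t')))
    simp only [χ, MonoidHom.coe_mk, OneHom.coe_mk, toAdd_ofAdd] at h1
    have hsub : ((t : ℂ) - t') ≠ 0 := by
      rw [← Complex.ofReal_sub]
      exact_mod_cast sub_ne_zero.2 hne
    have h2 : Complex.exp (t * ((Real.pi / (t - t') : ℝ) : ℂ) * Complex.I) =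
        Complex.exp (t' * ((Real.pi / (t - t') : ℝ) : ℂ) * Complex.I) *
          Complex.exp (Real.pi * Complex.I) := by
      rw [← Complex.exp_add]
      congr 1
      push_cast
      field_simp
      ring
    rw [h2, Complex.exp_pi_mul_I, mul_neg_one] at h1
    exact Complex.exp_ne_zero _ (self_eq_neg.1 h1.symm)
  have hli := (linearIndependent_monoidHom (Multiplicative ℝ) ℂ).comp χ hχ
  refine linearIndependent_iff'.1 hli T c ?_
  ext x
  simpa [expSum, χ] using h (Multiplicative.toAdd x)

/-- A combination of Dirac measures at points `T` of `[0, L]` is zero if its Fourier transform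
has more than `T.card` zeros in `[-Ω, Ω]`. -/
theorem diracSum_eq_zero {L Ω : ℝ} (hL : 0 < L) (hΩ : 0 < Ω) (hLΩ : 2 * Ω * L < 1)
    {T : Finset ℝ} (hT : ∀ t ∈ T, 0 ≤ t ∧ t ≤ L) {c : ℝ → ℂ} {S : Finset ℝ}
    (hS : ∀ ω ∈ S, ω ∈ Set.Icc (-Ω) Ω) (hS0 : ∀ ω ∈ S, measureFourier (diracSum T c) ω = 0)
    (hcard : T.card < S.card) : diracSum T c = 0 := by
  have hπ := Real.pi_pos
  by_cases hne : ∃ z, expSum T c z ≠ 0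
  · exfalso
    have hinj : Function.Injective fun ω : ℝ => -2 * Real.pi * ω := by
      intro a b hab
      have : -2 * Real.pi ≠ 0 := by linarith
      exact mul_left_cancel₀ this hab
    have hle := card_zeros_expSum_le hL.le hT c hne (S.image fun ω => -2 * Real.pi * ω)
      (x₀ := -(2 * Real.pi * Ω)) (x₁ := 2 * Real.pi * Ω)
      (by have : 0 < 2 * Real.pi * Ω := by positivity
          linarith) ?_ ?_
    · rw [Finset.card_image_of_injective _ hinj] at hle
      -- With m = `T.card`, the rescaled interval has length 4πΩ, which gives (m + 1)π ≤ (m - 1)π +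
      -- 4πΩL < (m + 1)π.
      have h1 : (T.card : ℝ) + 1 ≤ S.card := by exact_mod_cast hcard
      have h2 := mul_le_mul_of_nonneg_right h1 hπ.le
      have h3 := mul_lt_mul_of_pos_right hLΩ hπ
      nlinarith
    · intro w hw
      obtain ⟨ω, hω, rfl⟩ := Finset.mem_image.1 hw
      obtain ⟨h1, h2⟩ := hS ω hω
      constructor <;> nlinarith
    · intro w hw
      obtain ⟨ω, hω, rfl⟩ := Finset.mem_image.1 hw
      rw [← measureFourier_diracSum]
      exact hS0 ω hω
  · push Not at hne
    have h0 := eq_zero_of_expSum_eq_zero fun x : ℝ => hne x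
    exact Finset.sum_eq_zero fun t ht => by rw [h0 t ht]; exact zero_smul ℂ (_ : ComplexMeasure ℝ)

/-! ### Polarization and conclusion -/

/-- Polarization: the product `a * conj b` is determined by four magnitudes. -/
theorem mul_conj_eq_of_norm_sq_eq {a b a' b' : ℂ} (h1 : ‖a‖ ^ 2 = ‖a'‖ ^ 2)
    (h2 : ‖b‖ ^ 2 = ‖b'‖ ^ 2) (h3 : ‖a - b‖ ^ 2 = ‖a' - b'‖ ^ 2)
    (h4 : ‖a - Complex.I * b‖ ^ 2 = ‖a' - Complex.I * b'‖ ^ 2) :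
    a * (starRingEnd ℂ) b = a' * (starRingEnd ℂ) b' := by
  simp only [Complex.sq_norm, Complex.normSq_apply, Complex.sub_re, Complex.sub_im,
    Complex.mul_re, Complex.mul_im, Complex.I_re, Complex.I_im] at h1 h2 h3 h4
  apply Complex.ext
  · simp only [Complex.mul_re, Complex.conj_re, Complex.conj_im]
    linarith
  · simp only [Complex.mul_im, Complex.conj_re, Complex.conj_im]
    linarith

/-- Equal moduli mean b·conj b = b'·conj b'; comparing this with the edge relation cancels the
conjugates. This carries the phase from a vertex to its neighbour. -/
theorem div_eq_div_of_mul_conj_eq {a b a' b' : ℂ} (hb : ‖b‖ = ‖b'‖)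
    (ha' : a' ≠ 0) (hb' : b' ≠ 0)
    (h : a * (starRingEnd ℂ) b = a' * (starRingEnd ℂ) b') : a / a' = b / b' := by
  have hb0 : b ≠ 0 := by
    rw [← norm_ne_zero_iff, hb, norm_ne_zero_iff]
    exact hb'
  have hbb : b * (starRingEnd ℂ) b = b' * (starRingEnd ℂ) b' := by
    rw [Complex.mul_conj', Complex.mul_conj', hb]
  rw [div_eq_div_iff ha' hb']
  refine mul_right_cancel₀ ((map_ne_zero (starRingEnd ℂ)).2 hb0) ?_
  linear_combination b' * h - a' * hbb

theorem measureFourier_smul_of_mem {L : ℝ} {s : ℕ} {ν : ComplexMeasure ℝ}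
    (hν : ν ∈ diracCombinations L s) (u : ℂ) (ω : ℝ) :
    measureFourier (u • ν) ω = u * measureFourier ν ω := by
  obtain ⟨T, c, -, -, -, rfl⟩ := exists_eq_diracSum hν
  have h : u • diracSum T c = diracSum T fun t => u * c t := by
    simp only [diracSum, Finset.smul_sum, mul_smul]
  rw [h, measureFourier_diracSum, measureFourier_diracSum]
  simp only [expSum, Finset.mul_sum, mul_assoc]

/-- The Ramanujan bound `1 - 2 √(d - 1) / d` is positive. -/
theorem sub_two_mul_sqrt_pos {d : ℕ} (hd : 3 ≤ d) : 0 < (d : ℝ) - 2 * Real.sqrt ((d : ℝ) - 1) := by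
  have h3 : (3 : ℝ) ≤ d := by exact_mod_cast hd
  have h : Real.sqrt ((d : ℝ) - 1) < d / 2 := by
    rw [Real.sqrt_lt' (by linarith)]
    nlinarith
  linarith

/-- If the magnitudes of two measures agree, so do the products along every edge. -/
theorem mul_conj_eq_of_magnitudes_eq {n : ℕ} {G : SimpleGraph (Fin n)} {v : Fin n → ℝ}
    {f g : ℝ → ℂ} (h : magnitudes G v f = magnitudes G v g) {j k : Fin n} (hjk : G.Adj j k) :
    f (v j) * (starRingEnd ℂ) (f (v k)) = g (v j) * (starRingEnd ℂ) (g (v k)) := by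
  have key : ∀ j k : Fin n, j < k → G.Adj j k →
      f (v j) * (starRingEnd ℂ) (f (v k)) = g (v j) * (starRingEnd ℂ) (g (v k)) :=
    fun j k hlt hadj => mul_conj_eq_of_norm_sq_eq (congrFun h (Sum.inl j))
      (congrFun h (Sum.inl k)) (congrFun h (Sum.inr (Sum.inl ⟨(j, k), hlt, hadj⟩)))
      (congrFun h (Sum.inr (Sum.inr ⟨(j, k), hlt, hadj⟩)))
  rcases lt_or_gt_of_ne hjk.ne with hlt | hlt
  · exact key j k hlt hjk
  · have := congrArg (starRingEnd ℂ) (key k j hlt hjk.symm)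
    simpa [mul_comm] using this

theorem phaseEquiv_of_magnitudes_eq {L Ω : ℝ} (hL : 0 < L) (hΩ : 0 < Ω) (hLΩ : 2 * Ω * L < 1)
    {s : ℕ} (hs : 1 ≤ s) {d n : ℕ} {G : SimpleGraph (Fin n)} [DecidableRel G.Adj] (hd : 0 < d)
    (hreg : G.IsRegularOfDegree d) (hconn : G.Connected) {γ : ℝ} (hγ0 : 0 < γ) (hγ1 : γ ≤ 1)
    (hγ : γ ≤ spectralGap G) {v : Fin n → ℝ} (hv : Function.Injective v)
    (hvΩ : ∀ j, v j ∈ Set.Icc (-Ω) Ω) (hn : 6 * s < γ * n) {μ ν : ComplexMeasure ℝ}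
    (hμ : μ ∈ diracCombinations L s) (hν : ν ∈ diracCombinations L s)
    (h : magnitudes G v (measureFourier μ) = magnitudes G v (measureFourier ν)) :
    PhaseEquiv μ ν := by
  classical
  have hs1 : (1 : ℝ) ≤ s := by exact_mod_cast hs
  have hn6 : (6 * s : ℝ) < n := hn.trans_le (by nlinarith [(n.cast_nonneg : (0 : ℝ) ≤ n)])
  have hnorm : ∀ j, ‖measureFourier μ (v j)‖ = ‖measureFourier ν (v j)‖ := fun j =>
    (sq_eq_sq₀ (norm_nonneg _) (norm_nonneg _)).1 (congrFun h (Sum.inl j))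
  obtain ⟨T₁, c₁, hT₁, hT₁L, hc₁, hμ'⟩ := exists_eq_diracSum hμ
  obtain ⟨T₂, c₂, hT₂, hT₂L, hc₂, hν'⟩ := exists_eq_diracSum hν
  have hSmem : ∀ A : Finset (Fin n), ∀ ω ∈ A.image v, ω ∈ Set.Icc (-Ω) Ω := by
    intro A ω hω
    obtain ⟨j, _, rfl⟩ := Finset.mem_image.1 hω
    exact hvΩ j
  -- For ν = 0 every ratio is undefined; the n > s zeros of the transform of `μ` then force μ = 0.
  by_cases hν0 : ν = 0
  · have hfz : ∀ j, measureFourier μ (v j) = 0 := by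
      intro j
      rw [← norm_eq_zero, hnorm, norm_eq_zero, hν0]
      have : (0 : ComplexMeasure ℝ) = diracSum ∅ 0 := by simp [diracSum]
      rw [this, measureFourier_diracSum]
      simp [expSum]
    have hμ0 : μ = 0 := by
      rw [hμ']
      refine diracSum_eq_zero hL hΩ hLΩ hT₁L (hSmem Finset.univ) ?_ ?_
      · intro ω hω
        obtain ⟨j, _, rfl⟩ := Finset.mem_image.1 hω
        rw [← hμ']
        exact hfz j
      · rw [Finset.card_image_of_injective _ hv, Finset.card_univ, Fintype.card_fin]
        refine lt_of_le_of_lt hT₁ ?_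
        have : (s : ℝ) < n := by linarith
        exact_mod_cast this
    exact ⟨1, norm_one, by rw [hμ0, hν0]; exact (smul_zero (A := ComplexMeasure ℝ) (1 : ℂ)).symm⟩
  let Z : Finset (Fin n) := Finset.univ.filter fun j => measureFourier ν (v j) = 0
  have hZmem : ∀ j, j ∈ Z ↔ measureFourier ν (v j) = 0 := fun j => by simp [Z]
  have hZ : Z.card ≤ s := by
    by_contra hlt
    refine hν0 ?_
    rw [hν']
    refine diracSum_eq_zero hL hΩ hLΩ hT₂L (hSmem Z) ?_ ?_
    · intro ω hω
      obtain ⟨j, hj, rfl⟩ := Finset.mem_image.1 hω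
      rw [← hν']
      exact (hZmem j).1 hj
    · rw [Finset.card_image_of_injective _ hv]
      omega
  by_contra hnot
  let u : Fin n → ℂ := fun j => measureFourier μ (v j) / measureFourier ν (v j)
  have hu : ∀ i j, G.Adj i j → i ∉ Z → j ∉ Z → u i = u j := by
    intro i j hij hi hj
    rw [hZmem] at hi hj
    exact div_eq_div_of_mul_conj_eq (hnorm j) hi hj (mul_conj_eq_of_magnitudes_eq h hij)
  have hfib : ∀ a, (Zᶜ.filter fun j => u j = a).card ≤ 2 * s := by
    intro a
    by_contra hlt
    push Not at hlt
    obtain ⟨j₀, hj₀⟩ := Finset.card_pos.1 (lt_of_le_of_lt (Nat.zero_le _) hlt)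
    rw [Finset.mem_filter, Finset.mem_compl, hZmem] at hj₀
    refine hnot ⟨a, ?_, ?_⟩
    · rw [← hj₀.2, norm_div, hnorm, div_self (norm_ne_zero_iff.2 hj₀.1)]
    -- On the union of the two supports, μ - aν is carried by at most 2s points, while its transform
    -- vanishes on the whole level set.
    · have hμT := hμ'.trans (diracSum_eq_of_subset (Finset.subset_union_left (s₂ := T₂)) hc₁)
      have hνT := hν'.trans (diracSum_eq_of_subset (Finset.subset_union_right (s₁ := T₁)) hc₂)
      rw [← sub_eq_zero, hμT, hνT, diracSum_sub_smul]
      refine diracSum_eq_zero hL hΩ hLΩ ?_ (hSmem (Zᶜ.filter fun j => u j = a)) ?_ ?_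
      · intro t ht
        rcases Finset.mem_union.1 ht with ht | ht
        · exact hT₁L t ht
        · exact hT₂L t ht
      · intro ω hω
        obtain ⟨j, hj, rfl⟩ := Finset.mem_image.1 hω
        rw [Finset.mem_filter, Finset.mem_compl, hZmem] at hj
        rw [measureFourier_diracSum, expSum_sub_mul, ← measureFourier_diracSum,
          ← measureFourier_diracSum, ← hμT, ← hνT, ← hj.2, div_mul_cancel₀ _ hj.1, sub_self]
      · rw [Finset.card_image_of_injective _ hv]
        have := Finset.card_union_le T₁ T₂
        omega
  have hmain := card_le_of_level_sets_le hd hreg hconn hγ0.le hγ Z u hu (B := 2 * s)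
    fun a => by exact_mod_cast hfib a
  rw [Fintype.card_fin] at hmain
  have hn0 : (0 : ℝ) < n := by linarith
  have hZ' : (Z.card : ℝ) ≤ s := by exact_mod_cast hZ
  have hz0 : (0 : ℝ) ≤ Z.card := Nat.cast_nonneg _
  -- Together with |Z| ≤ s and γ ≤ 1 this gives γn ≤ s + 3γs ≤ 4s, contradicting `hn`.
  have hexpand : (n - 3 * s : ℝ) ≤ (n - Z.card) * (1 - 2 * s / n) := by
    have h1 : (n - Z.card : ℝ) * (1 - 2 * s / n) = n - Z.card - 2 * s + 2 * s * Z.card / n := by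
      field_simp
      ring
    rw [h1]
    have : (0 : ℝ) ≤ 2 * s * Z.card / n := by positivity
    linarith
  have h2 := mul_le_mul_of_nonneg_left hexpand hγ0.le
  nlinarith

theorem mainTheorem1 (L Ω : ℝ) (hL : 0 < L) (hΩ : 0 < Ω) (hLΩ : 2 * Ω * L < 1)
    (s : ℕ) (hs : 1 ≤ s) (d n : ℕ)
    (G : SimpleGraph (Fin n)) [DecidableRel G.Adj] (hG : IsRamanujan G d)
    (v : Fin n → ℝ) (hv : Function.Injective v) (hvΩ : ∀ j, v j ∈ Set.Icc (-Ω) Ω)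
    (hn : 6 * d * (1 + 6 / Real.log (s / (L * Ω))) * s / (d - 2 * Real.sqrt ((d : ℝ) - 1))
      < (n : ℝ)) :
    Nat.card (MeasurementIndex G) = (d + 1) * n ∧
    ∀ μ ∈ diracCombinations L s, ∀ ν ∈ diracCombinations L s,
      (magnitudes G v (measureFourier μ) = magnitudes G v (measureFourier ν) ↔
        PhaseEquiv μ ν) := by
  refine ⟨card_measurementIndex G hG.regular, fun μ hμ ν hν => ⟨fun h => ?_, ?_⟩⟩
  · have hd0 : 0 < d := by have := hG.three_le; omega
    have hdR : (0 : ℝ) < d := by exact_mod_cast hd0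
    have hs1 : (1 : ℝ) ≤ s := by exact_mod_cast hs
    have hD := sub_two_mul_sqrt_pos hG.three_le
    have hγ : 1 - 2 * Real.sqrt ((d : ℝ) - 1) / d = (d - 2 * Real.sqrt ((d : ℝ) - 1)) / d := by
      field_simp
    -- Since LΩ < 1/2 and s ≥ 1, the logarithm is positive. The factor 1 + 6/log is then at least 1,
    -- and `hn` yields 6s < γn.
    have hlog : 0 < Real.log (s / (L * Ω)) := by
      refine Real.log_pos ?_
      rw [one_lt_div (by positivity)]
      nlinarith
    refine phaseEquiv_of_magnitudes_eq hL hΩ hLΩ hs hd0 hG.regular hG.connected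
      (γ := 1 - 2 * Real.sqrt ((d : ℝ) - 1) / d) ?_ ?_ hG.gap hv hvΩ ?_ hμ hν h
    · rw [hγ]
      positivity
    · have : 0 ≤ 2 * Real.sqrt ((d : ℝ) - 1) / d := by positivity
      linarith
    · rw [div_lt_iff₀ hD] at hn
      have hκ : 6 * (d : ℝ) * s ≤ 6 * d * (1 + 6 / Real.log (s / (L * Ω))) * s := by
        have h6 : 0 ≤ 6 / Real.log (s / (L * Ω)) := by positivity
        have : 6 * (d : ℝ) * 1 * s ≤ 6 * d * (1 + 6 / Real.log (s / (L * Ω))) * s := by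
          gcongr
          linarith
        linarith
      rw [hγ, div_mul_eq_mul_div, lt_div_iff₀ hdR]
      linarith
  · rintro ⟨u, hu, rfl⟩
    have key : ∀ a b : ℂ, ‖u * a - u * b‖ = ‖a - b‖ := fun a b => by
      rw [← mul_sub, norm_mul, hu, one_mul]
    funext m
    rcases m with j | e | e
    · simp [magnitudes, measureFourier_smul_of_mem hν, hu]
    · simp only [magnitudes, measureFourier_smul_of_mem hν, key]
    · simp only [magnitudes, measureFourier_smul_of_mem hν, mul_left_comm Complex.I u, key]
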